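/- Let $B_k$ and $B_k(x)$ denote the Bernoulli numbers and polynomials, $\frac{ze^{xz}}{e^z-1}=\sum_{k\ge 0}\frac{B_k(x)}{k!}z^k$, $B_k=B_k(0)$, and for $k\ge1$ let $\bar B_k:\mathbb R\to\mathbb R$ be the periodic Bernoulli function: $\bar B_k(x)=B_k(x-\lfloor x\rfloor)$ for $x\notin\mathbb Z$, and for $x\in\mathbb Z$, $\bar B_k(x)=B_k$ if $k\ge2$ and $\bar B_1(x)=0$. For $i,j\ge1$, $p\in\mathbb Z$ and an integer $q\geq 1$, put $$s_{ij}(p,q)=\sum_{k=0}^{q-1}\bar B_i\!\left(\frac kq\right)\bar B_j\!\left(\frac{pk}q\right).$$ For even $N\ge2$ write $B_N=\alpha_N/\beta_N$ in lowest terms with $\beta_N>0$, and let $r_N$ be the least common multiple of the denominators (in lowest terms) of the rational numbers $$\beta_N\binom N{m+1}B_{m+1}B_{N-m-1},\qquad m\text{ odd},\ 0\le m\le N-2$$ (so $r_2=1$, the set being empty). For $i,j\ge 1$ with $N=i+j$ even put $R(i,j)=\binom Ni\,\beta_N\,r_N$. **Theorem.** Let $i,j\ge1$ be integers with $N=i+j$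 even, let $q\ge1$ and $p$ be coprime integers, and let $p'$ be any integer with $p'p\equiv1\pmod q$. Then $$R(i,j)\,q^{N-2}s_{ij}(p,q)-\frac{p'^{\,i}\,\alpha_N r_N\binom{N-1}i+p^{\,j}\,\alpha_N r_N\binom{N-1}j}{q}$$ is an integer. In particular $R(1,1)=12$, and for $i=j=1$ this is Rademacher's theorem: $12\,s_{11}(p,q)-\frac{p+p'}q$ is an integer. -/

import Mathlib

/-- The `k`-th periodic Bernoulli function `B̄ₖ : ℝ → ℝ`: it is `Bₖ(⟨x⟩)` when `x ∉ ℤ`, and at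
integers it is `0` for `k = 1` and the Bernoulli number `Bₖ` otherwise. -/
noncomputable def periodicBernoulli (k : ℕ) (x : ℝ) : ℝ :=
  if Int.fract x ≠ 0 then bernoulliFun k (Int.fract x)
  else if k = 1 then 0 else (bernoulli k : ℝ)

/-- The generalized Dedekind sum `s_{ij}(p,q) = ∑_{k=0}^{q-1} B̄ᵢ(k/q) B̄ⱼ(pk/q)`. -/
noncomputable def dedekindSum (i j : ℕ) (p : ℤ) (q : ℕ) : ℝ :=
  ∑ k ∈ Finset.range q,
    periodicBernoulli i ((k : ℝ) / (q : ℝ)) *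
      periodicBernoulli j ((p : ℝ) * (k : ℝ) / (q : ℝ))

/-- The numerator `α_N` of the `N`-th Bernoulli number, written in lowest terms. -/
def bernoulliNum (N : ℕ) : ℤ := (bernoulli N).num

/-- The (positive) denominator `β_N` of the `N`-th Bernoulli number, written in lowest terms. -/
def bernoulliDen (N : ℕ) : ℕ := (bernoulli N).den

/-- `r_N`, the least common multiple of the denominators of the rational numbers
`β_N * (N choose m+1) * B_{m+1} * B_{N-m-1}` over the odd `m` with `0 ≤ m ≤ N - 2`
(the empty least common multiple being `1`). Used for even `N ≥ 2`. -/
def bernoulliLcm (N : ℕ) : ℕ :=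
  ((Finset.Icc 0 (N - 2)).filter Odd).lcm fun m =>
    ((bernoulliDen N : ℚ) * (N.choose (m + 1) : ℚ) *
      bernoulli (m + 1) * bernoulli (N - m - 1)).den

/-- `R(i,j) = (N choose i) * β_N * r_N` with `N = i + j`. -/
def dedekindMultiplier (i j : ℕ) : ℕ :=
  (i + j).choose i * bernoulliDen (i + j) * bernoulliLcm (i + j)

/-!
For coprime `p` and `q` put `x = qt - py`. The theorem follows from an integrality statement about the
form `∑_{i+j=N} (N choose i) s_{ij}(p,q) xⁱ yʲ`: multiplied by `β_N r_N` and diminished by the explicit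
multiple `α_N r_N (x t^{N-1} + y w^{N-1})` of the numerator of `B_N`, it equals `x y` times a polynomial
in `t` and `y` with *integral* coefficients (`exists_mem_dedekindForm`). Here `w = p't + my` with
`pp' + qm = 1`, so that `t = (x + py)/q` and `w = (p'x + y)/q`. Taking `y = 1`, that polynomial has
degree at most `N - 2` in `t = (x + p)/q`, so `q^{N-2}` times each of its coefficients in `x` is an
integer; these coefficients are the numbers in the theorem, as the binomial theorem applied to
`t^{N-1}` and `w^{N-1}` shows.

The integrality is proved by the Euclidean algorithm. For `q = 1` it holds by the definition of `r_N`.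
Reducing `p` modulo `q` only changes the basis `t, y` of the lattice `ℤt + ℤy`. The remaining step is
the reciprocity law (`dedekindForm_reciprocity`) with `y' = -t`, which relates the forms of `(p, q)` at
`(x, y)`, of `(q, p)` at `(x, y')` and of `(0, 1)` at `(y, y')`, the last of which is explicit. The terms
in `B_N` cancel in it up to integral multiples, because `N - 1` is odd.

The reciprocity law is an identity of generating series. The series of the `s_{ij}(p,q)` is a sum of
exponentials divided by `(e^x - 1)(e^y - 1)`, and the exponents are integral combinations of `t` and
`y`. In terms of `u = e^t` and `v = e^{-y}` the law is Carlitz's identity for the sums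
`∑ u^k v^{⌊pk/q⌋}` (`carlitz_reciprocity`), which counts lattice points on both sides of a diagonal.
-/

/-! ### Carlitz's reciprocity -/

/-- Carlitz's polynomial reciprocity. Expanding each power `v ^ ⌊(P+1)(k+1)/(Q+1)⌋` as a geometric
sum turns the two sums into sums over the lattice points of a `Q × P` rectangle below and above its
diagonal; by coprimality no lattice point lies on the diagonal. -/
theorem carlitz_reciprocity {R : Type*} [CommRing R] (u v : R) (P Q : ℕ)
    (h : Nat.Coprime (P + 1) (Q + 1)) :
    (u - 1) * ∑ k ∈ Finset.range Q, u ^ k * v ^ ((P + 1) * (k + 1) / (Q + 1)) +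
      (v - 1) * ∑ l ∈ Finset.range P, v ^ l * u ^ ((Q + 1) * (l + 1) / (P + 1)) =
        u ^ Q * v ^ P - 1 := by
  have key : ∀ (P Q : ℕ) (v : R), ∀ k ∈ Finset.range Q,
      v ^ ((P + 1) * (k + 1) / (Q + 1)) = 1 + (v - 1) * ∑ l ∈ Finset.range P,
        if (Q + 1) * (l + 1) ≤ (P + 1) * (k + 1) then v ^ l else 0 := by
    intro P Q v k hk
    rw [Finset.mem_range] at hk
    -- For `k < Q` the points below the diagonal satisfy `l < P` automatically.
    have hfil : (Finset.range P).filter (fun l => (Q + 1) * (l + 1) ≤ (P + 1) * (k + 1)) =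
        Finset.range ((P + 1) * (k + 1) / (Q + 1)) := by
      ext l
      simp only [Finset.mem_filter, Finset.mem_range]
      rw [← Nat.succ_le_iff, ← Nat.succ_le_iff, Nat.le_div_iff_mul_le (Nat.succ_pos Q),
        Nat.succ_eq_add_one, mul_comm (l + 1) (Q + 1)]
      refine ⟨fun h => h.2, fun h => ⟨?_, h⟩⟩
      by_contra hl
      nlinarith
    rw [← Finset.sum_filter, hfil, mul_geom_sum]
    ring
  have hne : ∀ k ∈ Finset.range Q, ∀ l ∈ Finset.range P,
      (Q + 1) * (l + 1) ≠ (P + 1) * (k + 1) := by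
    intro k hk l _ he
    rw [Finset.mem_range] at hk
    have : (Q + 1) ∣ k + 1 := h.symm.dvd_of_dvd_mul_left (Dvd.intro _ he)
    exact absurd (Nat.le_of_dvd (Nat.succ_pos k) this) (by omega)
  have hrect : (∑ k ∈ Finset.range Q, ∑ l ∈ Finset.range P,
        u ^ k * (if (Q + 1) * (l + 1) ≤ (P + 1) * (k + 1) then v ^ l else 0)) +
      (∑ l ∈ Finset.range P, ∑ k ∈ Finset.range Q,
        v ^ l * (if (P + 1) * (k + 1) ≤ (Q + 1) * (l + 1) then u ^ k else 0)) =
      (∑ k ∈ Finset.range Q, u ^ k) * ∑ l ∈ Finset.range P, v ^ l := by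
    rw [Finset.sum_comm (s := Finset.range P), ← Finset.sum_add_distrib, Finset.sum_mul_sum]
    refine Finset.sum_congr rfl fun k hk => ?_
    rw [← Finset.sum_add_distrib]
    refine Finset.sum_congr rfl fun l hl => ?_
    have := hne k hk l hl
    rcases lt_or_gt_of_ne this with hlt | hlt
    · rw [if_pos hlt.le, if_neg hlt.not_ge]; ring
    · rw [if_neg hlt.not_ge, if_pos hlt.le]; ring
  have h1 : ∀ (P Q : ℕ) (u v : R),
      ∑ k ∈ Finset.range Q, u ^ k * v ^ ((P + 1) * (k + 1) / (Q + 1)) =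
      (∑ k ∈ Finset.range Q, u ^ k) + (v - 1) * ∑ k ∈ Finset.range Q, ∑ l ∈ Finset.range P,
        u ^ k * (if (Q + 1) * (l + 1) ≤ (P + 1) * (k + 1) then v ^ l else 0) := by
    intro P Q u v
    rw [Finset.mul_sum, ← Finset.sum_add_distrib]
    refine Finset.sum_congr rfl fun k hk => ?_
    rw [key P Q v k hk, ← Finset.mul_sum]
    ring
  rw [h1 P Q u v, h1 Q P v u]
  have hu := mul_geom_sum u Q
  have hv := mul_geom_sum v P
  linear_combination (u - 1) * (v - 1) * hrect +
    (v ^ P) * hu + hv * (1 + (u - 1) * ∑ k ∈ Finset.range Q, u ^ k)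

/-! ### Generating series of Dedekind sums -/

section GeneratingSeries

open PowerSeries

variable {K : Type*} [CommRing K]

section RealAlgebra

variable [Algebra ℝ K]

/-- The generating series `∑ B̄ₙ(r) (aX)ⁿ / n!` of the periodic Bernoulli functions at `r`. -/
noncomputable def periodicBernoulliSeries (r : ℝ) (a : K) : K⟦X⟧ :=
  PowerSeries.mk fun n => algebraMap ℝ K (periodicBernoulli n r / n.factorial) * a ^ n

/-- The generating series `∑ₖ (∑ᵢ B̄ᵢ(k/q) (xX)ⁱ / i!) (∑ⱼ B̄ⱼ(pk/q) (yX)ʲ / j!)` of the Dedekind sums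
`s_{ij}(p,q)`, including the indices `i = 0` and `j = 0`. -/
noncomputable def dedekindSeries (p : ℤ) (q : ℕ) (x y : K) : K⟦X⟧ :=
  ∑ k ∈ Finset.range q, periodicBernoulliSeries ((k : ℝ) / (q : ℝ)) x *
    periodicBernoulliSeries ((p : ℝ) * (k : ℝ) / (q : ℝ)) y

/-- The form `∑_{i+j=N} (N choose i) s_{ij}(p,q) xⁱ yʲ`, including its end terms `i = 0` and
`j = 0`. -/
noncomputable def dedekindForm (N : ℕ) (p : ℤ) (q : ℕ) (x y : K) : K :=
  ∑ ij ∈ Finset.HasAntidiagonal.antidiagonal N,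
    algebraMap ℝ K (N.choose ij.1 * dedekindSum ij.1 ij.2 p q) * (x ^ ij.1 * y ^ ij.2)

theorem factorial_mul_coeff_dedekindSeries (N : ℕ) (p : ℤ) (q : ℕ) (x y : K) :
    (N.factorial : K) * coeff N (dedekindSeries p q x y) = dedekindForm N p q x y := by
  simp only [dedekindSeries, map_sum, coeff_mul, periodicBernoulliSeries, coeff_mk, dedekindForm,
    dedekindSum]
  rw [Finset.sum_comm, Finset.mul_sum]
  refine Finset.sum_congr rfl fun ij hij => ?_
  simp only [Finset.mul_sum, Finset.sum_mul, map_sum]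
  refine Finset.sum_congr rfl fun k _ => ?_
  rw [Finset.HasAntidiagonal.mem_antidiagonal] at hij
  have hc : (N.choose ij.1 : ℝ) = N.factorial / (ij.1.factorial * ij.2.factorial) := by
    rw [← hij, Nat.cast_add_choose]
  rw [hc, ← map_natCast (algebraMap ℝ K) N.factorial]
  simp only [div_eq_mul_inv, map_mul, mul_inv]
  ring

end RealAlgebra

variable [Algebra ℚ K]

/-- The power series `e^{aX}`. -/
noncomputable def expSeries (a : K) : K⟦X⟧ := rescale a (exp K)

theorem expSeries_add (a b : K) : expSeries (a + b) = expSeries a * expSeries b :=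
  (exp_mul_exp_eq_exp_add a b).symm

theorem expSeries_zero : expSeries (0 : K) = 1 := by
  simp [expSeries]

theorem expSeries_nsmul (n : ℕ) (a : K) : expSeries ((n : K) * a) = expSeries a ^ n := by
  induction n with
  | zero => simp [expSeries_zero]
  | succ n ih => rw [Nat.cast_succ, add_mul, one_mul, expSeries_add, ih, pow_succ]

theorem expSeries_sub_one_ne_zero {a : K} (ha : a ≠ 0) : expSeries a - 1 ≠ 0 := by
  intro h
  have := congrArg (coeff 1) h
  simp [expSeries, coeff_exp, coeff_one] at this
  exact ha this

variable [Algebra ℝ K]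

theorem bernoulliFunSeries_mul (r : ℝ) (a : K) :
    (PowerSeries.mk fun n => algebraMap ℝ K (bernoulliFun n r / n.factorial) * a ^ n) *
      (expSeries a - 1) = C a * X * expSeries (algebraMap ℝ K r * a) := by
  have h := Polynomial.bernoulli_generating_function (algebraMap ℝ K r)
  have h2 := congrArg (rescale a) h
  rw [map_mul, map_mul, map_sub, map_one, rescale_X, rescale_rescale] at h2
  rw [← expSeries, ← expSeries] at h2
  rw [← h2]
  congr 1
  ext n
  rw [coeff_rescale, coeff_mk, coeff_mk, Polynomial.aeval_algebraMap_apply, mul_comm, bernoulliFun,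
    Polynomial.eval_map_algebraMap, map_smul, Rat.smul_def, div_eq_inv_mul]
  simp

theorem periodicBernoulliSeries_mul_of_fract_ne_zero {r : ℝ} (hr : Int.fract r ≠ 0) (a : K) :
    periodicBernoulliSeries r a * (expSeries a - 1) =
      C a * X * expSeries (algebraMap ℝ K (Int.fract r) * a) := by
  rw [← bernoulliFunSeries_mul]
  simp only [periodicBernoulliSeries, periodicBernoulli, if_pos hr]

/-- The identity `∑ B̄ₙ(0) (aX)ⁿ / n! = (aX/2) (e^{aX} + 1) / (e^{aX} - 1)`, cleared of denominators.
The value `B̄₁(0) = 0` in place of `B₁ = -1/2` is what makes the right-hand side symmetric. -/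
theorem two_mul_periodicBernoulliSeries_zero_mul (a : K) :
    2 * periodicBernoulliSeries 0 a * (expSeries a - 1) = C a * X * (expSeries a + 1) := by
  have h := bernoulliFunSeries_mul 0 a
  rw [map_zero, zero_mul, expSeries_zero, mul_one] at h
  have h2 : 2 * periodicBernoulliSeries 0 a =
      2 * (PowerSeries.mk fun n => algebraMap ℝ K (bernoulliFun n 0 / n.factorial) * a ^ n) +
        C a * X := by
    ext n
    have h2n : ∀ f : K⟦X⟧, coeff n (2 * f) = 2 * coeff n f := fun f => by
      rw [two_mul, two_mul, map_add]
    rw [map_add, h2n, h2n, periodicBernoulliSeries, coeff_mk, coeff_mk, coeff_C_mul, coeff_X,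
      bernoulliFun_eval_zero, periodicBernoulli, Int.fract_zero, if_neg (not_not.mpr rfl)]
    split_ifs with hn
    · subst hn
      have : (2 : K) = algebraMap ℝ K 2 := (map_ofNat _ 2).symm
      rw [this, ← mul_assoc, ← mul_assoc, ← map_mul, ← map_mul, pow_one, mul_one]
      norm_num [bernoulli_one]
    · rw [mul_zero, add_zero]
  rw [h2]
  linear_combination 2 * h

/-- For `x = qt - py` the exponents `(k/q) x + {pk/q} y` are the integral combinations
`kt - ⌊pk/q⌋ y` of `t` and `y`, so that the generating series becomes a sum of the kind occurring in
Carlitz's reciprocity, in `u = e^{tX}` and `v = e^{-yX}`. -/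
theorem four_mul_dedekindSeries_mul (p Q : ℕ) (h : Nat.Coprime p (Q + 1)) {t x y : K}
    (hx : x = ((Q + 1 : ℕ) : K) * t - p * y) :
    4 * dedekindSeries p (Q + 1) x y * ((expSeries x - 1) * (expSeries y - 1)) =
      C (x * y) * X ^ 2 * (4 * (∑ k ∈ Finset.range Q,
          expSeries t ^ (k + 1) * expSeries (-y) ^ (p * (k + 1) / (Q + 1))) +
        (expSeries x + 1) * (expSeries y + 1)) := by
  have hk : ∀ k ∈ Finset.range Q,
      periodicBernoulliSeries (((k + 1 : ℕ) : ℝ) / ((Q + 1 : ℕ) : ℝ)) x *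
        periodicBernoulliSeries (((p : ℤ) : ℝ) * ((k + 1 : ℕ) : ℝ) / ((Q + 1 : ℕ) : ℝ)) y *
        ((expSeries x - 1) * (expSeries y - 1)) = C (x * y) * X ^ 2 *
          (expSeries t ^ (k + 1) * expSeries (-y) ^ (p * (k + 1) / (Q + 1))) := by
    intro k hk
    rw [Finset.mem_range] at hk
    have hq : ((Q + 1 : ℕ) : ℝ) ≠ 0 := Nat.cast_ne_zero.mpr (Nat.succ_ne_zero Q)
    have hf1 : Int.fract (((k + 1 : ℕ) : ℝ) / ((Q + 1 : ℕ) : ℝ)) =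
        ((k + 1 : ℕ) : ℝ) / ((Q + 1 : ℕ) : ℝ) := by
      rw [Int.fract_div_natCast_eq_div_natCast_mod, Nat.mod_eq_of_lt (by omega)]
    have hf2 : Int.fract (((p : ℤ) : ℝ) * ((k + 1 : ℕ) : ℝ) / ((Q + 1 : ℕ) : ℝ)) =
        ((p * (k + 1) % (Q + 1) : ℕ) : ℝ) / ((Q + 1 : ℕ) : ℝ) := by
      rw [← Int.fract_div_natCast_eq_div_natCast_mod, Nat.cast_mul, Int.cast_natCast]
    have hmod : p * (k + 1) % (Q + 1) ≠ 0 := by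
      intro h0
      have := Nat.le_of_dvd (Nat.succ_pos k) (h.symm.dvd_of_dvd_mul_left (Nat.dvd_of_mod_eq_zero h0))
      omega
    have e1 := periodicBernoulliSeries_mul_of_fract_ne_zero
      (r := ((k + 1 : ℕ) : ℝ) / ((Q + 1 : ℕ) : ℝ))
      (by rw [hf1]; exact div_ne_zero (Nat.cast_ne_zero.mpr (Nat.succ_ne_zero k)) hq) x
    have e2 := periodicBernoulliSeries_mul_of_fract_ne_zero
      (r := ((p : ℤ) : ℝ) * ((k + 1 : ℕ) : ℝ) / ((Q + 1 : ℕ) : ℝ))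
      (by rw [hf2]; exact div_ne_zero (Nat.cast_ne_zero.mpr hmod) hq) y
    rw [hf1] at e1
    rw [hf2] at e2
    have hexp : expSeries (algebraMap ℝ K (((k + 1 : ℕ) : ℝ) / ((Q + 1 : ℕ) : ℝ)) * x) *
        expSeries (algebraMap ℝ K (((p * (k + 1) % (Q + 1) : ℕ) : ℝ) / ((Q + 1 : ℕ) : ℝ)) * y) =
        expSeries t ^ (k + 1) * expSeries (-y) ^ (p * (k + 1) / (Q + 1)) := by
      rw [← expSeries_nsmul, ← expSeries_nsmul, ← expSeries_add, ← expSeries_add]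
      congr 1
      have hdm : ((p * (k + 1) % (Q + 1) : ℕ) : K) =
          p * (k + 1 : ℕ) - (Q + 1 : ℕ) * (p * (k + 1) / (Q + 1) : ℕ) := by
        have := congrArg (Nat.cast (R := K)) (Nat.div_add_mod (p * (k + 1)) (Q + 1))
        rw [Nat.cast_add, Nat.cast_mul, Nat.cast_mul] at this
        linear_combination this
      have hinv : algebraMap ℝ K ((Q + 1 : ℕ) : ℝ)⁻¹ * ((Q + 1 : ℕ) : K) = 1 := by
        rw [← map_natCast (algebraMap ℝ K), ← map_mul, inv_mul_cancel₀ hq, map_one]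
      rw [div_eq_mul_inv, div_eq_mul_inv, map_mul, map_mul, map_natCast, map_natCast, hdm, hx]
      linear_combination (((k + 1 : ℕ) : K) * t - (p * (k + 1) / (Q + 1) : ℕ) * y) * hinv
    rw [← hexp, map_mul]
    linear_combination (periodicBernoulliSeries
      (((p : ℤ) : ℝ) * ((k + 1 : ℕ) : ℝ) / ((Q + 1 : ℕ) : ℝ)) y * (expSeries y - 1)) * e1 +
      (C x * X * expSeries (algebraMap ℝ K (((k + 1 : ℕ) : ℝ) / ((Q + 1 : ℕ) : ℝ)) * x)) * e2
  have h0 := two_mul_periodicBernoulliSeries_zero_mul x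
  have h0' := two_mul_periodicBernoulliSeries_zero_mul y
  have hs := Finset.sum_congr rfl hk
  rw [← Finset.sum_mul, ← Finset.mul_sum] at hs
  rw [dedekindSeries, Finset.sum_range_succ', Nat.cast_zero, mul_zero, zero_div]
  rw [map_mul] at hs ⊢
  linear_combination 4 * hs + (2 * periodicBernoulliSeries 0 y * (expSeries y - 1)) * h0 +
    (C x * X * (expSeries x + 1)) * h0'

/-! ### The reciprocity law -/

/-- The reciprocity law for the generating series: with `y' = -t`, so that `x + py + qy' = 0`,
dividing by `x y y' X²` expresses that a cotangent-type cocycle is constant. -/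
theorem dedekindSeries_reciprocity [IsDomain K] {p q : ℕ} (hp : 0 < p) (hq : 0 < q)
    (h : Nat.Coprime p q) {t x y : K} (hxt : x = q * t - p * y)
    (hx : x ≠ 0) (hy : y ≠ 0) (ht : t ≠ 0) :
    4 * (C (-t) * dedekindSeries p q x y + C y * dedekindSeries q p x (-t) +
      C x * dedekindSeries 0 1 y (-t)) = -(C (x * y * -t) * X ^ 2) := by
  obtain ⟨P, rfl⟩ := Nat.exists_eq_succ_of_ne_zero hp.ne'
  obtain ⟨Q, rfl⟩ := Nat.exists_eq_succ_of_ne_zero hq.ne'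
  have e1 := four_mul_dedekindSeries_mul (P + 1) Q h hxt
  have e2 := four_mul_dedekindSeries_mul (Q + 1) P h.symm (t := -y) (x := x) (y := -t)
    (by rw [hxt]; ring)
  have e3 := four_mul_dedekindSeries_mul 0 0 (by simp) (t := y) (x := y) (y := -t) (by simp)
  have hc := carlitz_reciprocity (expSeries t) (expSeries (-y)) P Q h
  have hu : expSeries t * expSeries (-t) = 1 := by
    rw [← expSeries_add, add_neg_cancel, expSeries_zero]
  have hv : expSeries (-y) * expSeries y = 1 := by
    rw [← expSeries_add, neg_add_cancel, expSeries_zero]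
  -- `x + y - t = (q - 1) t - (p - 1) y`.
  have ha : expSeries x * expSeries y * expSeries (-t) =
      expSeries t ^ Q * expSeries (-y) ^ P := by
    rw [← expSeries_nsmul, ← expSeries_nsmul, ← expSeries_add, ← expSeries_add, ← expSeries_add,
      hxt]
    congr 1
    push_cast
    ring
  rw [neg_neg] at e2
  -- Everything is multiplied by `(e^x - 1)(e^y - 1)(e^{-t} - 1)`, after which only exponentials remain.
  refine mul_right_cancel₀ (mul_ne_zero (mul_ne_zero (expSeries_sub_one_ne_zero hx)
    (expSeries_sub_one_ne_zero hy)) (expSeries_sub_one_ne_zero (neg_ne_zero.mpr ht))) ?_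
  have s1 : ∑ k ∈ Finset.range Q,
        expSeries t ^ (k + 1) * expSeries (-y) ^ ((P + 1) * (k + 1) / (Q + 1)) =
      expSeries t * ∑ k ∈ Finset.range Q,
        expSeries t ^ k * expSeries (-y) ^ ((P + 1) * (k + 1) / (Q + 1)) := by
    rw [Finset.mul_sum]
    exact Finset.sum_congr rfl fun k _ => by ring
  have s2 : ∑ k ∈ Finset.range P,
        expSeries (-y) ^ (k + 1) * expSeries t ^ ((Q + 1) * (k + 1) / (P + 1)) =
      expSeries (-y) * ∑ k ∈ Finset.range P,
        expSeries (-y) ^ k * expSeries t ^ ((Q + 1) * (k + 1) / (P + 1)) := by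
    rw [Finset.mul_sum]
    exact Finset.sum_congr rfl fun k _ => by ring
  rw [s1] at e1
  rw [s2] at e2
  simp only [Finset.range_zero, Finset.sum_empty, Nat.cast_zero, zero_add] at e3
  simp only [Nat.succ_eq_add_one, map_mul, map_neg] at *
  -- What is left is an identity of polynomials in the exponentials and the two Carlitz sums.
  generalize (∑ k ∈ Finset.range Q, expSeries t ^ k *
    expSeries (-y) ^ ((P + 1) * (k + 1) / (Q + 1))) = S at *
  generalize (∑ k ∈ Finset.range P, expSeries (-y) ^ k *
    expSeries t ^ ((Q + 1) * (k + 1) / (P + 1))) = S' at *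
  generalize expSeries x = a at *
  generalize expSeries y = V at *
  generalize expSeries (-y) = v at *
  generalize expSeries (-t) = U at *
  generalize expSeries t = u at *
  linear_combination (-(C t) * (U - 1)) * e1 + C y * (V - 1) * e2 + C x * (a - 1) * e3 +
    (-(C x * C y * C t) * X ^ 2) * (4 * S * hu + 4 * S' * hv - 4 * hc + 4 * ha)

theorem dedekindForm_reciprocity [IsDomain K] (N : ℕ) {p q : ℕ} (hp : 0 < p) (hq : 0 < q)
    (h : Nat.Coprime p q) {t x y : K} (hxt : x = q * t - p * y)
    (hx : x ≠ 0) (hy : y ≠ 0) (ht : t ≠ 0) :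
    4 * (-t * dedekindForm N p q x y + y * dedekindForm N q p x (-t) +
      x * dedekindForm N 0 1 y (-t)) = if N = 2 then 2 * (x * y * t) else 0 := by
  have e := congrArg (fun f => (N.factorial : K) * coeff N f)
    (dedekindSeries_reciprocity hp hq h hxt hx hy ht)
  have h4 : (4 : K⟦X⟧) = C 4 := (map_ofNat C 4).symm
  simp only [h4, coeff_C_mul, map_add, map_neg (coeff N), coeff_X_pow] at e
  simp only [← factorial_mul_coeff_dedekindSeries]
  split_ifs with hN
  · subst hN
    rw [if_pos rfl, Nat.factorial_two] at e
    rw [Nat.factorial_two]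
    push_cast at e ⊢
    linear_combination e
  · rw [if_neg hN] at e
    linear_combination e

end GeneratingSeries

/-! ### Integrality of products of Bernoulli numbers -/

theorem bernoulliDen_two : bernoulliDen 2 = 6 := by
  rw [bernoulliDen, bernoulli_two]
  norm_num

theorem bernoulliNum_two : bernoulliNum 2 = 1 := by
  rw [bernoulliNum, bernoulli_two]
  norm_num

theorem bernoulliLcm_two : bernoulliLcm 2 = 1 := by
  rw [bernoulliLcm, show (Finset.Icc 0 (2 - 2)).filter Odd = ∅ by decide, Finset.lcm_empty]

/-- This is the property for which `r_N` is defined. When `i` is odd the product vanishes, as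
`B̄₁(0) = 0` and `Bᵢ = 0` for odd `i ≥ 3`. -/
theorem exists_int_bernoulli_product {i j N : ℕ} (hi : 1 ≤ i) (hj : 1 ≤ j) (hij : i + j = N) :
    ∃ n : ℤ, (bernoulliDen N : ℝ) * bernoulliLcm N *
      (N.choose i * (periodicBernoulli i 0 * periodicBernoulli j 0)) = n := by
  simp only [periodicBernoulli, Int.fract_zero, if_neg (not_not.mpr rfl)]
  split_ifs with h1 h2 h2
  · exact ⟨0, by simp⟩
  · exact ⟨0, by simp⟩
  · exact ⟨0, by simp⟩
  rcases Nat.even_or_odd i with he | ho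
  · set b : ℚ := (bernoulliDen N : ℚ) * (N.choose i : ℚ) * bernoulli i * bernoulli j with hb
    have hdvd : b.den ∣ bernoulliLcm N := by
      -- The product is the term `m = i - 1` in the definition of `r_N`.
      have hm : i - 1 ∈ (Finset.Icc 0 (N - 2)).filter Odd := by
        rw [Finset.mem_filter, Finset.mem_Icc]
        exact ⟨⟨Nat.zero_le _, by omega⟩, by grind⟩
      have := Finset.dvd_lcm (f := fun m => ((bernoulliDen N : ℚ) * (N.choose (m + 1) : ℚ) *
        bernoulli (m + 1) * bernoulli (N - m - 1)).den) hm
      simp only [Nat.sub_add_cancel hi, show N - (i - 1) - 1 = j by omega] at this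
      exact this
    obtain ⟨c, hc⟩ := hdvd
    refine ⟨b.num * c, ?_⟩
    have h : (bernoulliDen N : ℚ) * bernoulliLcm N * (N.choose i * (bernoulli i * bernoulli j)) =
        ((b.num * c : ℤ) : ℚ) := by
      have hd := Rat.mul_den_eq_num b
      rw [hc]
      push_cast
      rw [← hd, hb]
      ring
    exact_mod_cast congrArg (Rat.cast (K := ℝ)) h
  · exact ⟨0, by rw [bernoulli_eq_zero_of_odd ho (by omega)]; simp⟩

/-! ### Integrality of the Dedekind form -/

theorem dedekindSum_zero_one (i j : ℕ) :
    dedekindSum i j 0 1 = periodicBernoulli i 0 * periodicBernoulli j 0 := by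
  simp [dedekindSum]

theorem periodicBernoulli_zero_left (x : ℝ) : periodicBernoulli 0 x = 1 := by
  simp [periodicBernoulli]

theorem periodicBernoulli_add_intCast (k : ℕ) (x : ℝ) (m : ℤ) :
    periodicBernoulli k (x + m) = periodicBernoulli k x := by
  simp [periodicBernoulli]

section Integrality

variable {K : Type*} [CommRing K] [Algebra ℝ K]

theorem dedekindForm_add_two (n : ℕ) (p : ℤ) (q : ℕ) (x y : K) :
    dedekindForm (n + 2) p q x y =
      algebraMap ℝ K (dedekindSum 0 (n + 2) p q) * y ^ (n + 2) +
        algebraMap ℝ K (dedekindSum (n + 2) 0 p q) * x ^ (n + 2) +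
        x * y * ∑ ij ∈ Finset.HasAntidiagonal.antidiagonal n,
          algebraMap ℝ K ((n + 2).choose (ij.1 + 1) * dedekindSum (ij.1 + 1) (ij.2 + 1) p q) *
            (x ^ ij.1 * y ^ ij.2) := by
  rw [dedekindForm, Finset.Nat.antidiagonal_succ_succ']
  simp only [Finset.sum_cons, Finset.sum_map, Finset.mul_sum]
  rw [← add_assoc]
  congr 1
  · simp
  · refine Finset.sum_congr rfl fun ij _ => ?_
    simp
    ring

/-- For `q = 1` only the two end terms of the form, which are multiples of `B_N`, can fail to be
integral. -/
theorem exists_mem_dedekindForm_zero_one {N : ℕ} (hN2 : 2 ≤ N) {x y : K}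
    (A : Subring K) (hx : x ∈ A) (hy : y ∈ A) :
    ∃ g ∈ A, (bernoulliDen N : K) * bernoulliLcm N * dedekindForm N 0 1 x y =
      (bernoulliNum N : K) * bernoulliLcm N * (x ^ N + y ^ N) + x * y * g := by
  obtain ⟨n, rfl⟩ := Nat.exists_eq_add_of_le' hN2
  have hB : (bernoulliDen (n + 2) : K) * algebraMap ℝ K (periodicBernoulli (n + 2) 0) =
      bernoulliNum (n + 2) := by
    have h := congrArg (fun r : ℚ => algebraMap ℝ K (r : ℝ))
      (Rat.mul_den_eq_num (bernoulli (n + 2)))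
    rw [periodicBernoulli, Int.fract_zero, if_neg (not_not.mpr rfl), if_neg (by omega)]
    simp only [Rat.cast_mul, Rat.cast_natCast, Rat.cast_intCast, map_mul, map_natCast,
      map_intCast] at h
    rw [mul_comm]
    exact h
  refine ⟨∑ ij ∈ Finset.HasAntidiagonal.antidiagonal n, algebraMap ℝ K
    (bernoulliDen (n + 2) * bernoulliLcm (n + 2) *
      ((n + 2).choose (ij.1 + 1) * dedekindSum (ij.1 + 1) (ij.2 + 1) 0 1)) *
    (x ^ ij.1 * y ^ ij.2), A.sum_mem fun ij hij => ?_, ?_⟩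
  · rw [Finset.HasAntidiagonal.mem_antidiagonal] at hij
    obtain ⟨m, hm⟩ := exists_int_bernoulli_product (i := ij.1 + 1) (j := ij.2 + 1) (N := n + 2)
      (by omega) (by omega) (by omega)
    rw [dedekindSum_zero_one, hm, map_intCast]
    exact A.mul_mem (intCast_mem A m) (A.mul_mem (A.pow_mem hx _) (A.pow_mem hy _))
  · rw [dedekindForm_add_two, dedekindSum_zero_one, dedekindSum_zero_one,
      periodicBernoulli_zero_left, one_mul, mul_one]
    simp only [map_mul, mul_assoc, ← Finset.mul_sum, map_natCast]
    linear_combination (bernoulliLcm (n + 2) : K) * (x ^ (n + 2) + y ^ (n + 2)) * hB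

theorem dedekindForm_add_mul (N : ℕ) (p k : ℤ) {q : ℕ} (hq : 0 < q) (x y : K) :
    dedekindForm N (p + q * k) q x y = dedekindForm N p q x y := by
  have h : ∀ i j, dedekindSum i j (p + q * k) q = dedekindSum i j p q := fun i j => by
    refine Finset.sum_congr rfl fun l _ => ?_
    congr 1
    rw [← periodicBernoulli_add_intCast j ((p : ℝ) * l / q) (k * l)]
    congr 1
    have : (q : ℝ) ≠ 0 := by positivity
    push_cast
    field_simp
  simp only [dedekindForm, h]

/-- The integrality statement behind the theorem, for linearly independent `t` and `y` and
`x = qt - py`: up to the explicit end terms coming from `B_N`, the form `β_N r_N ∑ (N choose i) s_{ij} xⁱ yʲ`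
is `x y` times an integral polynomial in `t` and `y`. The proof is the Euclidean algorithm on
`(p, q)`: replacing `p` by its residue modulo `q` changes `t` by a multiple of `y`, and the
reciprocity law replaces `(p, q, t, y)` by `(q, p, -y, -t)`. -/
theorem exists_mem_dedekindForm [Algebra ℚ K] [IsDomain K] {N : ℕ} (hN : Even N) (hN2 : 2 ≤ N)
    (A : Subring K) (q : ℕ) (hq : 0 < q) :
    ∀ p p' m : ℤ, p * p' + q * m = 1 → ∀ t y : K,
      (∀ a b : ℤ, (a : K) * t + b * y = 0 → a = 0 ∧ b = 0) → t ∈ A → y ∈ A →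
      ∃ h ∈ A, (q * t - p * y) * y * h =
        (bernoulliDen N : K) * bernoulliLcm N * dedekindForm N p q (q * t - p * y) y -
          (bernoulliNum N : K) * bernoulliLcm N *
            ((q * t - p * y) * t ^ (N - 1) + y * (p' * t + m * y) ^ (N - 1)) := by
  obtain ⟨n, rfl⟩ := Nat.exists_eq_add_of_le' hN2
  rw [show n + 2 - 1 = n + 1 by omega]
  induction q using Nat.strong_induction_on with
  | _ q ih =>
  -- It suffices to treat `0 ≤ p < q`.
  suffices H : ∀ p : ℕ, p < q → ∀ p' m : ℤ, p * p' + q * m = 1 → ∀ t y : K,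
      (∀ a b : ℤ, (a : K) * t + b * y = 0 → a = 0 ∧ b = 0) → t ∈ A → y ∈ A →
      ∃ h ∈ A, (q * t - p * y) * y * h =
        (bernoulliDen (n + 2) : K) * bernoulliLcm (n + 2) *
            dedekindForm (n + 2) p q (q * t - p * y) y -
          (bernoulliNum (n + 2) : K) * bernoulliLcm (n + 2) *
            ((q * t - p * y) * t ^ (n + 1) + y * (p' * t + m * y) ^ (n + 1)) by
    intro p p' m hpm t y hind ht hy
    have hq' : (q : ℤ) ≠ 0 := by omega
    obtain ⟨p₀, hp₀⟩ := Int.eq_ofNat_of_zero_le (Int.emod_nonneg p hq')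
    have hlt : p₀ < q := by
      have := Int.emod_lt_of_pos p (show (0 : ℤ) < q by omega)
      omega
    have hp : p = p₀ + q * (p / q) := by
      rw [← hp₀, Int.emod_add_mul_ediv]
    set k := p / q
    obtain ⟨h, hhA, hh⟩ := H p₀ hlt p' (m + k * p') (by rw [← hpm, hp]; ring) (t - k * y) y
      (fun a b hab => by
        obtain ⟨h1, h2⟩ := hind a (b - a * k) (by push_cast; linear_combination hab)
        subst h1
        exact ⟨rfl, by simpa using h2⟩)
      (A.sub_mem ht (A.mul_mem (intCast_mem A k) hy)) hy
    -- The end term in `t` changes by a multiple of `y`, as `t ≡ t - k y` modulo `y`.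
    obtain ⟨g, hgA, hg⟩ : ∃ g ∈ A, t ^ (n + 1) - (t - k * y) ^ (n + 1) = y * g := by
      refine ⟨k * ∑ i ∈ Finset.range (n + 1), t ^ i * (t - k * y) ^ (n + 1 - 1 - i),
        A.mul_mem (intCast_mem A k) (A.sum_mem fun i _ => A.mul_mem (A.pow_mem ht _)
          (A.pow_mem (A.sub_mem ht (A.mul_mem (intCast_mem A k) hy)) _)), ?_⟩
      have := (Commute.all t (t - k * y)).geom_sum₂_mul (n + 1)
      linear_combination -this
    have hpK : (p : K) = p₀ + q * k := by rw [hp]; push_cast; ring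
    have hform := dedekindForm_add_mul (n + 2) p₀ k hq (q * t - p * y) y
    rw [← hp] at hform
    -- Both `x` and `w` are unchanged by the reduction of `p`.
    have hx : (q : K) * (t - k * y) - p₀ * y = q * t - p * y := by rw [hpK]; ring
    have hw : (p' : K) * (t - k * y) + ((m + k * p' : ℤ) : K) * y = p' * t + m * y := by
      push_cast; ring
    rw [hx, hw] at hh
    refine ⟨h - (bernoulliNum (n + 2) : K) * bernoulliLcm (n + 2) * g,
      A.sub_mem hhA (A.mul_mem (A.mul_mem (intCast_mem A _) (natCast_mem A _)) hgA), ?_⟩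
    rw [hform]
    linear_combination hh + (bernoulliNum (n + 2) : K) * bernoulliLcm (n + 2) *
      (q * t - p * y) * hg
  intro p hpq p' m hpm t y hind ht hy
  have ht0 : t ≠ 0 := fun h => by simpa using (hind 1 0 (by simp [h])).1
  have hy0 : y ≠ 0 := fun h => by simpa using (hind 0 1 (by simp [h])).2
  rcases Nat.eq_zero_or_pos p with rfl | hp
  · obtain rfl : q = 1 := by
      have : (q : ℤ) ∣ 1 := ⟨m, by rw [← hpm]; simp⟩
      exact Nat.dvd_one.mp (by exact_mod_cast this)
    obtain rfl : m = 1 := by simpa using hpm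
    obtain ⟨g, hgA, hg⟩ := exists_mem_dedekindForm_zero_one hN2 A ht hy
    obtain ⟨f, hfA, hf⟩ : ∃ f ∈ A, (p' * t + y) ^ (n + 1) - y ^ (n + 1) = t * f := by
      refine ⟨p' * ∑ i ∈ Finset.range (n + 1), (p' * t + y) ^ i * y ^ (n + 1 - 1 - i),
        A.mul_mem (intCast_mem A p') (A.sum_mem fun i _ => A.mul_mem (A.pow_mem
          (A.add_mem (A.mul_mem (intCast_mem A p') ht) hy) _) (A.pow_mem hy _)), ?_⟩
      have := (Commute.all (p' * t + y) y).geom_sum₂_mul (n + 1)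
      linear_combination -this
    refine ⟨g - (bernoulliNum (n + 2) : K) * bernoulliLcm (n + 2) * f,
      A.sub_mem hgA (A.mul_mem (A.mul_mem (intCast_mem A _) (natCast_mem A _)) hfA), ?_⟩
    simp only [Nat.cast_one, one_mul, Nat.cast_zero, zero_mul, sub_zero, Int.cast_one]
    linear_combination -hg + (bernoulliNum (n + 2) : K) * bernoulliLcm (n + 2) * y * hf
  · have hcop : Nat.Coprime p q := by
      rw [← Nat.isCoprime_iff_coprime]
      exact ⟨p', m, by linear_combination hpm⟩
    have hx0 : (q : K) * t - p * y ≠ 0 := fun h => by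
      have := (hind q (-p) (by push_cast; linear_combination h)).1
      omega
    obtain ⟨h, hhA, hh⟩ := ih p hpq hp q m p' (by rw [← hpm]; ring) (-y) (-t)
      (fun a b hab => by
        obtain ⟨h1, h2⟩ := hind (-b) (-a) (by push_cast; linear_combination hab)
        exact ⟨by simpa using h2, by simpa using h1⟩)
      (A.neg_mem hy) (A.neg_mem ht)
    obtain ⟨g, hgA, hg⟩ := exists_mem_dedekindForm_zero_one hN2 A hy (A.neg_mem ht)
    have hrec := dedekindForm_reciprocity (n + 2) hp hq hcop rfl hx0 hy0 ht0
    -- The constant of the reciprocity law occurs only for `N = 2`, where `β_N r_N = 6` makes it `3`.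
    obtain ⟨s, hs⟩ : ∃ s : ℤ, (bernoulliDen (n + 2) : K) * bernoulliLcm (n + 2) *
        (-t * dedekindForm (n + 2) p q (q * t - p * y) y +
          y * dedekindForm (n + 2) q p (q * t - p * y) (-t) +
          (q * t - p * y) * dedekindForm (n + 2) 0 1 y (-t)) = s * ((q * t - p * y) * y * t) := by
      have : CharZero K := algebraRat.charZero K
      have h4 : (4 : K) ≠ 0 := by norm_num
      split_ifs at hrec with hn
      · obtain rfl : n = 0 := by omega
        refine ⟨3, mul_left_cancel₀ h4 ?_⟩
        rw [bernoulliDen_two, bernoulliLcm_two]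
        push_cast
        linear_combination 6 * hrec
      · exact ⟨0, by rw [(mul_eq_zero.mp hrec).resolve_left h4]; simp⟩
    rw [show (p : K) * -y - (q : ℤ) * -t = q * t - p * y by push_cast; ring,
      show (m : K) * -y + p' * -t = -(p' * t + m * y) by ring] at hh
    have ho : Odd (n + 1) := by
      rw [Nat.even_add] at hN
      exact (hN.mpr even_two).add_one
    -- Since `N - 1` is odd, the end terms of `(p, q)`, `(q, p)` and `(0, 1)` cancel.
    rw [ho.neg_pow, ho.neg_pow] at hh
    rw [hN.neg_pow] at hg
    refine ⟨-h - g - s, A.sub_mem (A.sub_mem (A.neg_mem hhA) hgA) (intCast_mem A s),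
      mul_left_cancel₀ (neg_ne_zero.mpr ht0) ?_⟩
    linear_combination -y * hh + (q * t - p * y) * hg - hs

end Integrality

/-! ### Extraction of coefficients -/

open Polynomial in
theorem exists_int_pow_mul_coeff_eval₂ (f : ℤ[X]) (p : ℤ) {q : ℕ} (hq : 0 < q) {d : ℕ}
    (hd : f.natDegree ≤ d) (k : ℕ) :
    ∃ z : ℤ, (q : ℝ) ^ d *
      (f.eval₂ (Int.castRingHom ℝ[X]) (C (q : ℝ)⁻¹ * (X + C (p : ℝ)))).coeff k = z := by
  have hq' : (q : ℝ) ≠ 0 := by positivity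
  refine ⟨∑ l ∈ Finset.range (d + 1), f.coeff l * q ^ (d - l) * (p ^ (l - k) * l.choose k), ?_⟩
  rw [eval₂_eq_sum_range' _ (Nat.lt_succ_of_le hd), finsetSum_coeff, Finset.mul_sum]
  push_cast
  refine Finset.sum_congr rfl fun l hl => ?_
  rw [Finset.mem_range] at hl
  rw [mul_pow, ← C_pow, eq_intCast, ← C_eq_intCast, coeff_C_mul, coeff_C_mul, coeff_X_add_C_pow,
    ← Nat.sub_add_cancel (Nat.le_of_lt_succ hl), pow_add, Nat.add_sub_cancel, inv_pow]
  field_simp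

open Polynomial in
theorem coeff_dedekindForm_X_one (N : ℕ) (p : ℤ) (q : ℕ) (i : ℕ) :
    (dedekindForm N p q (X : ℝ[X]) 1).coeff i =
      if i ≤ N then N.choose i * dedekindSum i (N - i) p q else 0 := by
  rw [dedekindForm, Finset.Nat.sum_antidiagonal_eq_sum_range_succ_mk, finsetSum_coeff]
  simp only [one_pow, mul_one, algebraMap_eq, coeff_C_mul, coeff_X_pow, mul_ite, mul_zero]
  rw [Finset.sum_ite_eq]
  simp

open Polynomial in
/-- The specialization of `exists_mem_dedekindForm` at `x = X`, `y = 1` in `ℝ[X]`, where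
`t = (X + p) / q` and `p' t + m = (p' X + 1) / q`. -/
theorem exists_intPolynomial_dedekindForm {N : ℕ} (hN : Even N) (hN2 : 2 ≤ N) {q : ℕ} (hq : 0 < q)
    {p p' : ℤ} (h : p' * p ≡ 1 [ZMOD (q : ℤ)]) :
    ∃ f : ℤ[X], X * f.eval₂ (Int.castRingHom ℝ[X]) (C (q : ℝ)⁻¹ * (X + C (p : ℝ))) =
      C ((bernoulliDen N : ℝ) * bernoulliLcm N) * dedekindForm N p q X 1 -
        C ((bernoulliNum N : ℝ) * bernoulliLcm N / q ^ (N - 1)) *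
          (X * (X + C (p : ℝ)) ^ (N - 1) + ((X + 1) ^ (N - 1)).comp (C (p' : ℝ) * X)) := by
  obtain ⟨m, hm⟩ := h.dvd
  have hq' : (q : ℝ) ≠ 0 := by positivity
  have hqC : C (q : ℝ) * C (q : ℝ)⁻¹ = 1 := by rw [← C_mul, mul_inv_cancel₀ hq', C_1]
  have hx : (q : ℝ[X]) * (C (q : ℝ)⁻¹ * (X + C (p : ℝ))) - (p : ℝ[X]) * 1 = X := by
    rw [← C_eq_natCast, ← C_eq_intCast]
    linear_combination (X + C (p : ℝ)) * hqC
  have hw : (p' : ℝ[X]) * (C (q : ℝ)⁻¹ * (X + C (p : ℝ))) + (m : ℝ[X]) * 1 =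
      C (q : ℝ)⁻¹ * (C (p' : ℝ) * X + 1) := by
    have hmC : 1 - C (p' : ℝ) * C (p : ℝ) = C (q : ℝ) * C (m : ℝ) := by
      have := congrArg (fun z : ℤ => C (z : ℝ)) hm
      simpa using this
    rw [← C_eq_intCast, ← C_eq_intCast]
    linear_combination -C (q : ℝ)⁻¹ * hmC - C (m : ℝ) * hqC
  obtain ⟨g, ⟨f, rfl⟩, hg⟩ := exists_mem_dedekindForm hN hN2
    (eval₂RingHom (Int.castRingHom ℝ[X]) (C (q : ℝ)⁻¹ * (X + C (p : ℝ)))).range q hq p p' m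
    (by linear_combination -hm) (C (q : ℝ)⁻¹ * (X + C (p : ℝ))) 1
    (fun a b hab => by
      rw [← C_eq_intCast, ← C_eq_intCast] at hab
      have h1 := congrArg (fun f => coeff f 1) hab
      have h0 := congrArg (fun f => coeff f 0) hab
      simp only [mul_one, coeff_add, coeff_C_mul, coeff_X_one, coeff_X_zero, coeff_C_zero,
        coeff_C_succ, coeff_zero, add_zero, zero_add, mul_eq_zero, inv_eq_zero, hq',
        or_false] at h1 h0
      rw [h1, zero_mul, zero_add] at h0
      exact ⟨by exact_mod_cast h1, by exact_mod_cast h0⟩)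
    ⟨X, by simp⟩ (one_mem _)
  refine ⟨f, ?_⟩
  rw [hx, hw, mul_one, one_mul, mul_pow, mul_pow, coe_eval₂RingHom] at hg
  rw [hg, div_eq_mul_inv, ← inv_pow]
  simp only [C_mul, C_pow, C_eq_natCast, C_eq_intCast, pow_comp, add_comp, X_comp, one_comp]
  ring

open Polynomial in
/-- The sums `s_{0N}(p,q) = q^{1-N} B_N`, multiplied by `β_N r_N`. The value is the constant
coefficient of the polynomial identity, whose other side is divisible by `X`. -/
theorem dedekindSum_zero_left {N : ℕ} (hN : Even N) (hN2 : 2 ≤ N) {q : ℕ} (hq : 0 < q)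
    {p p' : ℤ} (h : p' * p ≡ 1 [ZMOD (q : ℤ)]) :
    (bernoulliDen N : ℝ) * bernoulliLcm N * dedekindSum 0 N p q =
      (bernoulliNum N : ℝ) * bernoulliLcm N / q ^ (N - 1) := by
  obtain ⟨f, hf⟩ := exists_intPolynomial_dedekindForm hN hN2 hq h
  have := congrArg (fun f => coeff f 0) hf
  simp only [coeff_X_mul_zero, coeff_sub, coeff_add, coeff_C_mul, coeff_dedekindForm_X_one,
    comp_C_mul_X_coeff, coeff_X_add_one_pow] at this
  simp at this
  linear_combination -this

/-- The sums `s_{N0}(p,q)` do not depend on `p`. -/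
theorem dedekindSum_zero_right (N : ℕ) (p : ℤ) (q : ℕ) :
    dedekindSum N 0 p q = dedekindSum 0 N 1 q := by
  simp [dedekindSum, periodicBernoulli_zero_left]

open Polynomial in
theorem exists_int_dedekindSum {i j : ℕ} (hi : 1 ≤ i) (hj : 1 ≤ j) (hN : Even (i + j)) {q : ℕ}
    (hq : 0 < q) {p p' : ℤ} (h : p' * p ≡ 1 [ZMOD (q : ℤ)]) :
    ∃ n : ℤ, (dedekindMultiplier i j : ℝ) * (q : ℝ) ^ (i + j - 2) * dedekindSum i j p q -
      ((p' : ℝ) ^ i * (bernoulliNum (i + j) : ℝ) * (bernoulliLcm (i + j) : ℝ) *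
          ((i + j - 1).choose i : ℝ) +
        (p : ℝ) ^ j * (bernoulliNum (i + j) : ℝ) * (bernoulliLcm (i + j) : ℝ) *
          ((i + j - 1).choose j : ℝ)) / (q : ℝ) = (n : ℝ) := by
  obtain ⟨i, rfl⟩ := Nat.exists_eq_add_of_le' hi
  obtain ⟨j, rfl⟩ := Nat.exists_eq_add_of_le' hj
  have hN2 : 2 ≤ i + 1 + (j + 1) := by omega
  have hq' : (q : ℝ) ≠ 0 := by positivity
  obtain ⟨f, hf⟩ := exists_intPolynomial_dedekindForm hN hN2 hq h
  have hcoeff : ∀ k, (f.eval₂ (Int.castRingHom ℝ[X]) (C (q : ℝ)⁻¹ * (X + C (p : ℝ)))).coeff k = _ :=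
    fun k => by rw [← coeff_X_mul, hf]
  simp only [coeff_sub, coeff_add, coeff_C_mul, coeff_dedekindForm_X_one, coeff_X_mul,
    comp_C_mul_X_coeff, coeff_X_add_one_pow, coeff_X_add_C_pow] at hcoeff
  -- The degree of `f` is that of a polynomial in `X` whose coefficient at `N - 1` vanishes,
  -- being `β_N r_N s_{N0} - α_N r_N q^{1-N}`.
  have hdeg : f.natDegree ≤ i + j := by
    have hcomp : f.eval₂ (Int.castRingHom ℝ[X]) (C (q : ℝ)⁻¹ * (X + C (p : ℝ))) =
        (f.map (Int.castRingHom ℝ)).comp (C (q : ℝ)⁻¹ * (X + C (p : ℝ))) := by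
      rw [comp, eval₂_map]
      congr 1
    have hfd : f.natDegree =
        (f.eval₂ (Int.castRingHom ℝ[X]) (C (q : ℝ)⁻¹ * (X + C (p : ℝ)))).natDegree := by
      rw [hcomp, natDegree_comp, natDegree_C_mul (inv_ne_zero hq'), natDegree_X_add_C, mul_one,
        natDegree_map_eq_of_injective (RingHom.injective_int _)]
    rw [hfd, natDegree_le_iff_coeff_eq_zero]
    intro k hk
    rw [hcoeff]
    rcases (Nat.succ_le_of_lt hk).eq_or_lt with rfl | hk
    · have := dedekindSum_zero_left (p := 1) (p' := 1) hN hN2 hq rfl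
      rw [if_pos (by omega), show i + 1 + (j + 1) - 1 = (i + j).succ by omega,
        show i + 1 + (j + 1) = (i + j).succ + 1 by omega, Nat.sub_self, Nat.sub_self,
        Nat.choose_self, Nat.choose_self, Nat.choose_succ_self, dedekindSum_zero_right]
      rw [show i + 1 + (j + 1) - 1 = (i + j).succ by omega,
        show i + 1 + (j + 1) = (i + j).succ + 1 by omega] at this
      push_cast
      linear_combination this
    · rw [if_neg (by omega), Nat.choose_eq_zero_of_lt (by omega),
        Nat.choose_eq_zero_of_lt (by omega)]
      simp
  obtain ⟨z, hz⟩ := exists_int_pow_mul_coeff_eval₂ f p hq hdeg i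
  refine ⟨z, ?_⟩
  rw [← hz, hcoeff]
  have hsymm : (i + j + 1).choose i = (i + j + 1).choose (j + 1) :=
    Nat.choose_symm_of_eq_add (by omega)
  rw [if_pos (by omega), show i + 1 + (j + 1) - 1 - i = j + 1 by omega,
    show i + 1 + (j + 1) - (i + 1) = j + 1 by omega, show i + 1 + (j + 1) - 2 = i + j by omega,
    show i + 1 + (j + 1) - 1 = i + j + 1 by omega, hsymm, dedekindMultiplier]
  push_cast
  field_simp
  ring

theorem dedekindMultiplier_one_one : dedekindMultiplier 1 1 = 12 := by
  rw [dedekindMultiplier, bernoulliDen_two, bernoulliLcm_two]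
  rfl

theorem mainTheorem1 :
    (∀ (i j : ℕ), 1 ≤ i → 1 ≤ j → Even (i + j) →
      ∀ (p : ℤ) (q : ℕ) (p' : ℤ), 0 < q → IsCoprime p (q : ℤ) → p' * p ≡ 1 [ZMOD (q : ℤ)] →
        ∃ n : ℤ,
          (dedekindMultiplier i j : ℝ) * (q : ℝ) ^ (i + j - 2) * dedekindSum i j p q -
            ((p' : ℝ) ^ i * (bernoulliNum (i + j) : ℝ) * (bernoulliLcm (i + j) : ℝ) *
                ((i + j - 1).choose i : ℝ) +
              (p : ℝ) ^ j * (bernoulliNum (i + j) : ℝ) * (bernoulliLcm (i + j) : ℝ) *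
                ((i + j - 1).choose j : ℝ)) / (q : ℝ) = (n : ℝ)) ∧
    (dedekindMultiplier 1 1 = 12 ∧
      ∀ (p : ℤ) (q : ℕ) (p' : ℤ), 0 < q → IsCoprime p (q : ℤ) → p' * p ≡ 1 [ZMOD (q : ℤ)] →
        ∃ n : ℤ,
          12 * dedekindSum 1 1 p q - ((p : ℝ) + (p' : ℝ)) / (q : ℝ) = (n : ℝ)) := by
  have main : ∀ (i j : ℕ), 1 ≤ i → 1 ≤ j → Even (i + j) →
      ∀ (p : ℤ) (q : ℕ) (p' : ℤ), 0 < q → IsCoprime p (q : ℤ) → p' * p ≡ 1 [ZMOD (q : ℤ)] → _ :=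
    fun i j hi hj hN p q p' hq _ h => exists_int_dedekindSum hi hj hN hq h
  refine ⟨main, dedekindMultiplier_one_one, fun p q p' hq hpq h => ?_⟩
  obtain ⟨n, hn⟩ := main 1 1 le_rfl le_rfl even_two p q p' hq hpq h
  refine ⟨n, ?_⟩
  rw [← hn, dedekindMultiplier_one_one, bernoulliNum_two, bernoulliLcm_two]
  norm_num [add_comm]
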